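/- Let $\sigma$ be a permutation of $\{1,\dots,n\}$, $n\ge 1$, written as the word $\sigma_1\cdots\sigma_n$. It is *separable* if it avoids the patterns $3142$ and $2413$. *Binary separating tree.* A binary ordered tree with $n$ leaves and internal vertices labeled $+$ or $-$ is a binary separating tree of $\sigma$ if, when its leaves are decorated from left to right by $\sigma_1,\dots,\sigma_n$, the leaves below every vertex carry a set of values that is an interval, and at each vertex labeled $+$ (resp. $-$) all values below the left child are smaller (resp. larger) than all values below the right child. A *contracted separating tree* of $\sigma$ is the ordered labeled tree obtained from a binary separating tree of $\sigma$ by contracting every edge between two internal vertices of the same sign (the decoration of the leaves is forgotten). *Decomposition tree.* A common interval of $\sigma$ is a nonempty block of consecutive entries of $\sigma$ whose set of values is an interval of integers. It is strong if it overlaps no other common interval, where $I$ and $J$ overlap if $I\setminus J$, $J\setminus I$ and $I\cap J$ are all nonempty. The strong intervals ordered by inclusion form an ordered tree with root $\sigma$ and with leaves $\sigma_1,\dots,\sigma_n$ from left to right. An internal node with children $V_1,\dots,V_k$ from left to right is *prime* if $k\ge 3$ and no union $V_i\cup\dots\cup V_j$ with $1\le i<j\le k$ and $(i,j)\ne(1,k)$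 is an interval; otherwise it is *linear* (so nodes with two children are linear). The tree with these node types is the *common interval decomposition tree* of $\sigma$. The *labeled decomposition tree* of $\sigma$ is obtained from it by labeling each linear node $+$ or $-$ according as the values in its children increase or decrease from left to right, labeling each prime node by the permutation that describes the relative order of the values in its children, and forgetting the intervals. **Proposition.** 1. $\sigma$ is separable if and only if its common interval decomposition tree has no prime node. 2. If $\sigma$ is separable, then it has exactly one contracted separating tree (that is, $\sigma$ has a binary separating tree, and all its binary separating trees contract to the same tree), and this tree equals the labeled decomposition tree of $\sigma$. -/

import Mathlib

/-!
Permutations of size `m` are elements `σ : Equiv.Perm (Fin m)`; positions and values are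
numbered from `0`, so the one-line notation `σ 0, σ 1, …, σ (m - 1)` is the usual one shifted
by one.
-/

namespace SepPerm

/-! ### Patterns and separable permutations -/

/-- `π` is a pattern of `σ`: some subsequence of `σ` is order-isomorphic to `π`. -/
def IsPattern {k m : ℕ} (π : Equiv.Perm (Fin k)) (σ : Equiv.Perm (Fin m)) : Prop :=
  ∃ f : Fin k → Fin m, StrictMono f ∧ ∀ i j, π i < π j → σ (f i) < σ (f j)

/-- The permutation `3 1 4 2`. -/
def perm3142 : Equiv.Perm (Fin 4) where
  toFun := ![2, 0, 3, 1]
  invFun := ![1, 3, 0, 2]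
  left_inv := by decide
  right_inv := by decide

/-- The permutation `2 4 1 3`. -/
def perm2413 : Equiv.Perm (Fin 4) where
  toFun := ![1, 3, 0, 2]
  invFun := ![2, 0, 3, 1]
  left_inv := by decide
  right_inv := by decide

/-- `σ` is separable: it avoids `3 1 4 2` and `2 4 1 3`. -/
def IsSeparable {m : ℕ} (σ : Equiv.Perm (Fin m)) : Prop :=
  ¬ IsPattern perm3142 σ ∧ ¬ IsPattern perm2413 σ

/-! ### Ordered trees -/

/-- Finite ordered rooted trees with internal vertices carrying data in `N` and leaves carrying
data in `L`. -/
inductive OTree (N L : Type) : Type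
  | leaf (l : L) : OTree N L
  | node (a : N) (cs : List (OTree N L)) : OTree N L

/-- Replace the data at internal vertices by `f` and the data at leaves by `g`. -/
def OTree.map {N L N' L' : Type} (f : N → N') (g : L → L') : OTree N L → OTree N' L'
  | .leaf l => .leaf (g l)
  | .node a cs => .node (f a) (cs.map (OTree.map f g))

/-- Some internal vertex of the tree carries the data `a`. -/
inductive OTree.HasNode {N L : Type} (a : N) : OTree N L → Prop
  | root (cs : List (OTree N L)) : HasNode a (.node a cs)
  | child (b : N) (cs : List (OTree N L)) (c : OTree N L) (hc : c ∈ cs) (h : HasNode a c) :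
      HasNode a (.node b cs)

/-- The signs `+` and `-`. -/
inductive Sgn : Type
  | plus
  | minus
  deriving DecidableEq

/-- Labels of internal vertices: a sign (linear vertices), or a permutation of the children
(prime vertices). -/
inductive Label : Type
  | linear (s : Sgn)
  | prime (d : ℕ) (π : Equiv.Perm (Fin d))

/-- Ordered trees with labels on the internal vertices and no data on the leaves. -/
abbrev LabeledTree : Type := OTree Label Unit

/-! ### Binary separating trees and contracted separating trees -/

/-- Binary ordered trees whose internal vertices are labeled by a sign. -/
inductive BinTree : Type
  | leaf : BinTree
  | node (s : Sgn) (l r : BinTree) : BinTree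

/-- `Decorates T w i j`: writing the word `w` on the leaves of `T` from left to right decorates
the root by a permutation of the nonempty interval `{i, …, j - 1}` in such a way that, at each
internal vertex, for some `h`, the part of the interval below `h` goes to the left child
if the sign is `+` and to the right child if the sign is `-`, and the rest to the other child. -/
inductive Decorates : BinTree → List ℕ → ℕ → ℕ → Prop
  | leaf (i : ℕ) : Decorates .leaf [i] i (i + 1)
  | plus (l r : BinTree) (u v : List ℕ) (i h j : ℕ)
      (hl : Decorates l u i h) (hr : Decorates r v h j) :
      Decorates (.node .plus l r) (u ++ v) i j
  | minus (l r : BinTree) (u v : List ℕ) (i h j : ℕ)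
      (hl : Decorates l u h j) (hr : Decorates r v i h) :
      Decorates (.node .minus l r) (u ++ v) i j

/-- `T` is a binary separating tree of `σ`. -/
def IsBinarySeparatingTree {m : ℕ} (σ : Equiv.Perm (Fin m)) (T : BinTree) : Prop :=
  Decorates T (List.ofFn fun k => (σ k : ℕ)) 0 m

/-- The children contributed by a contracted subtree `t` below a vertex of sign `s`: if the root
of `t` has sign `s` too, then the edge is contracted and the children of that root move up. -/
def absorb (s : Sgn) : LabeledTree → List LabeledTree
  | .node (.linear s') cs => if s' = s then cs else [.node (.linear s') cs]
  | t => [t]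

/-- Contract every edge between internal vertices of the same sign. -/
def contract : BinTree → LabeledTree
  | .leaf => .leaf ()
  | .node s l r => .node (.linear s) (absorb s (contract l) ++ absorb s (contract r))

/-- `C` is obtained from some binary separating tree of `σ` by contracting every edge between
vertices of the same sign. -/
def IsContractedSeparatingTree {m : ℕ} (σ : Equiv.Perm (Fin m)) (C : LabeledTree) : Prop :=
  ∃ T : BinTree, IsBinarySeparatingTree σ T ∧ contract T = C

/-! ### Common intervals and the common interval decomposition tree -/

/-- A block `(a, b)` stands for the set of consecutive positions `a, …, b`. -/
abbrev Block (m : ℕ) : Type := Fin m × Fin m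

/-- The set of positions in a block. -/
def Block.positions {m : ℕ} (I : Block m) : Set (Fin m) := Set.Icc I.1 I.2

/-- The entries of `σ` in a (nonempty) block form an interval of integers. -/
def IsCommonInterval {m : ℕ} (σ : Equiv.Perm (Fin m)) (I : Block m) : Prop :=
  I.1 ≤ I.2 ∧ (σ '' I.positions).OrdConnected

/-- Two blocks overlap. -/
def Overlap {m : ℕ} (I J : Block m) : Prop :=
  (I.positions \ J.positions).Nonempty ∧ (J.positions \ I.positions).Nonempty ∧
    (I.positions ∩ J.positions).Nonempty

/-- Strong common intervals: common intervals that overlap no common interval. -/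
def IsStrongInterval {m : ℕ} (σ : Equiv.Perm (Fin m)) (I : Block m) : Prop :=
  IsCommonInterval σ I ∧ ∀ J : Block m, IsCommonInterval σ J → ¬ Overlap I J

/-- `J` is a child of `I` in the inclusion order of the strong intervals: a maximal strong
interval strictly included in `I`. -/
def IsChild {m : ℕ} (σ : Equiv.Perm (Fin m)) (I J : Block m) : Prop :=
  IsStrongInterval σ J ∧ J.positions ⊂ I.positions ∧
    ∀ K : Block m, IsStrongInterval σ K → J.positions ⊆ K.positions →
      K.positions ⊂ I.positions → K = J

open Classical in
/-- The children of `I`, from left to right (the pairs are listed in lexicographic order, and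
distinct children are disjoint). -/
noncomputable def children {m : ℕ} (σ : Equiv.Perm (Fin m)) (I : Block m) : List (Block m) :=
  (List.finRange m ×ˢ List.finRange m).filter fun J => IsChild σ I J

theorem children_decreasing {m : ℕ} {σ : Equiv.Perm (Fin m)} {I J : Block m}
    (hJ : J ∈ children σ I) :
    (Finset.Icc J.1 J.2).card < (Finset.Icc I.1 I.2).card := by
  classical
  have h : IsChild σ I J := by simpa [children] using (List.mem_filter.1 hJ).2
  apply Finset.card_lt_card
  rw [← Finset.coe_ssubset, Finset.coe_Icc, Finset.coe_Icc]
  exact h.2.1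

/-- The tree of the strong intervals included in `I`, each vertex carrying its block. -/
noncomputable def strongTree {m : ℕ} (σ : Equiv.Perm (Fin m)) (I : Block m) :
    OTree (Block m) (Block m) :=
  if I.1 = I.2 then .leaf I
  else .node I ((children σ I).attach.map fun J => strongTree σ J.1)
termination_by (Finset.Icc I.1 I.2).card
decreasing_by exact children_decreasing J.2

/-- The two types of internal vertices. -/
inductive NodeType : Type
  | P
  | L

/-- An internal vertex with children `V₁, …, V_k` (left to right) is prime if `k ≥ 3` and no union
`V_i ∪ ⋯ ∪ V_j` with `i < j` and `(i, j) ≠ (1, k)` is an interval. -/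
def IsPrimeNode {m : ℕ} (σ : Equiv.Perm (Fin m)) (I : Block m) : Prop :=
  3 ≤ (children σ I).length ∧
    ∀ i j : Fin (children σ I).length, i < j →
      (⋃ l ∈ Set.Icc i j, σ '' ((children σ I).get l).positions).OrdConnected →
        (i : ℕ) = 0 ∧ (j : ℕ) + 1 = (children σ I).length

open Classical in
/-- The type of an internal vertex; vertices that are not prime (in particular all those with two
children) are linear. -/
noncomputable def nodeType {m : ℕ} (σ : Equiv.Perm (Fin m)) (I : Block m) : NodeType :=
  if IsPrimeNode σ I then .P else .L

/-- The common interval decomposition tree of `σ`: each vertex is decorated by its strong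
interval, and each internal vertex also carries its type. -/
noncomputable def commonIntervalTree {n : ℕ} (σ : Equiv.Perm (Fin (n + 1))) :
    OTree (NodeType × Block (n + 1)) (Block (n + 1)) :=
  (strongTree σ (0, Fin.last n)).map (fun I => (nodeType σ I, I)) id

/-- The values in the children of `I` increase from left to right. -/
def ChildrenIncrease {m : ℕ} (σ : Equiv.Perm (Fin m)) (I : Block m) : Prop :=
  (children σ I).Pairwise fun J K => ∀ x ∈ J.positions, ∀ y ∈ K.positions, σ x < σ y

/-- For the list `V₁, …, V_d` of the children of a vertex: the permutation `π` with `π i < π j` if and only if the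
values in `V_i` are smaller than those in `V_j`. The value sets of distinct children are disjoint
intervals, so they are compared by comparing one value of each, here that at the first position.
`Tuple.sort f` lists the indices by increasing value of `f`, so its inverse gives the ranks. -/
def childrenPerm {m : ℕ} (σ : Equiv.Perm (Fin m)) (cs : List (Block m)) :
    Equiv.Perm (Fin cs.length) :=
  (Tuple.sort fun i => σ (cs.get i).1)⁻¹

open Classical in
/-- The label of an internal vertex: for a linear vertex, `+` if the values in its children
increase from left to right and `-` otherwise (they then decrease); for a prime vertex, the
permutation that describes the relative order of its children. -/
noncomputable def nodeLabel {m : ℕ} (σ : Equiv.Perm (Fin m)) : NodeType × Block m → Label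
  | (.P, I) => .prime (children σ I).length (childrenPerm σ (children σ I))
  | (.L, I) => if ChildrenIncrease σ I then .linear .plus else .linear .minus

/-- The labeled decomposition tree of `σ`: the common interval decomposition tree, with its
internal vertices labeled and the decoration forgotten. -/
noncomputable def labeledDecompositionTree {n : ℕ} (σ : Equiv.Perm (Fin (n + 1))) :
    LabeledTree :=
  (commonIntervalTree σ).map (nodeLabel σ) fun _ => ()

end SepPerm

namespace SepPerm

/-! A direct or skew sum decomposition of a window of positions provides the root of a separating
tree. Hence `σ` has a separating tree as soon as every common interval with at least two entries
splits (`exists_separates_of_splits`). Two hypotheses ensure this. If `σ` avoids both patterns,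
every window of length at least two splits (`Avoids.splits`). If there is no prime node, a common
interval that is not strong is cut by one overlapping it (`CommonInt.splits_of_not_strongInt`), and
a strong one is a linear node, which splits too (`splits_of_not_isPrimeNode`). Conversely, a
separating tree excludes the patterns (`Separates.avoids`), since neither of them is a direct or
skew sum.

For uniqueness, let a tree with root sign `s` separate a strong interval, and consider the subtrees
hanging below the maximal connected set of `s`-vertices at the root. Their windows are exactly the
children of the interval: they are strong because each is a leaf or has a root of the opposite sign
(`IsPart.strongInt`), and maximal because initial and final unions of them are common intervals
(`IsPart.eq_of_strongInt`). The node is linear with label `s`, and induction identifies the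
contraction with the labeled subtree (`contract_eq_labeledSubtree`). The latter does not depend on
the separating tree. Since contractions carry only signs, the existence of a separating tree also
excludes prime nodes. -/

/-- The value of `f` at `x`, with the order of values reversed for the sign `-`. -/
def signedVal (f : ℕ → ℕ) : Sgn → ℕ → ℤ
  | .plus, x => f x
  | .minus, x => -f x

/-- The positions `c, …, b - 1` all have larger signed values than the positions
`a, …, c - 1`. -/
def SplitsAt (f : ℕ → ℕ) (s : Sgn) (a c b : ℕ) : Prop :=
  ∀ x y, a ≤ x → x < c → c ≤ y → y < b → signedVal f s x < signedVal f s y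

/-- The window of positions `a, …, b - 1` is a direct or skew sum. -/
def Splits (f : ℕ → ℕ) (a b : ℕ) : Prop :=
  ∃ s c, a < c ∧ c < b ∧ SplitsAt f s a c b

/-- The positions `a, …, b - 1` form a common interval of the word `f 0, …, f (m - 1)`. -/
def CommonInt (f : ℕ → ℕ) (m a b : ℕ) : Prop :=
  a < b ∧ b ≤ m ∧ ∀ x y z, a ≤ x → x < b → a ≤ y → y < b → z < m →
    f x < f z → f z < f y → a ≤ z ∧ z < b

/-- The half-open intervals `[a, b)` and `[c, d)` overlap. -/
def NatOverlap (a b c d : ℕ) : Prop :=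
  (a < c ∧ c < b ∧ b < d) ∨ (c < a ∧ a < d ∧ d < b)

/-- The positions `a, …, b - 1` form a strong interval of the word `f 0, …, f (m - 1)`. -/
def StrongInt (f : ℕ → ℕ) (m a b : ℕ) : Prop :=
  CommonInt f m a b ∧ ∀ c d, CommonInt f m c d → ¬ NatOverlap a b c d

/-- `T` is a separating tree of the window of positions `a, …, b - 1`. -/
inductive Separates (f : ℕ → ℕ) : BinTree → ℕ → ℕ → Prop
  | leaf (a : ℕ) : Separates f .leaf a (a + 1)
  | node (s : Sgn) (l r : BinTree) (a c b : ℕ) (hl : Separates f l a c)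
      (hr : Separates f r c b) (h : SplitsAt f s a c b) : Separates f (.node s l r) a b

/-- The word `f 0, …, f (m - 1)` avoids `3142` (sign `+`) and `2413` (sign `-`). -/
def Avoids (f : ℕ → ℕ) (a b : ℕ) : Prop :=
  ∀ s p q r t, a ≤ p → p < q → q < r → r < t → t < b →
    ¬ (signedVal f s q < signedVal f s t ∧ signedVal f s t < signedVal f s p ∧
      signedVal f s p < signedVal f s r)

/-! ### Splitting windows, separating trees and pattern avoidance -/

variable {f : ℕ → ℕ} {m : ℕ}

theorem signedVal_of_ne {s s' : Sgn} (h : s' ≠ s) (x : ℕ) :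
    signedVal f s' x = -signedVal f s x := by
  cases s <;> cases s' <;> simp_all [signedVal]

theorem signedVal_injective (hf : Function.Injective f) (s : Sgn) :
    Function.Injective (signedVal f s) := by
  intro x y h
  apply hf
  cases s <;> simpa [signedVal] using h

theorem CommonInt.mem {a b : ℕ} (h : CommonInt f m a b) (s : Sgn) {x y z : ℕ}
    (hx : a ≤ x) (hx' : x < b) (hy : a ≤ y) (hy' : y < b) (hz : z < m)
    (h₁ : signedVal f s x < signedVal f s z) (h₂ : signedVal f s z < signedVal f s y) :
    a ≤ z ∧ z < b := by
  cases s <;> simp only [signedVal] at h₁ h₂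
  · exact h.2.2 x y z hx hx' hy hy' hz (by omega) (by omega)
  · exact h.2.2 y x z hy hy' hx hx' hz (by omega) (by omega)

theorem commonInt_of_signedVal (s : Sgn) {a b : ℕ} (hab : a < b) (hb : b ≤ m)
    (h : ∀ x y z, a ≤ x → x < b → a ≤ y → y < b → z < m →
      signedVal f s x < signedVal f s z → signedVal f s z < signedVal f s y → a ≤ z ∧ z < b) :
    CommonInt f m a b := by
  refine ⟨hab, hb, fun x y z hx hx' hy hy' hz h₁ h₂ => ?_⟩
  cases s <;> simp only [signedVal] at h
  · exact h x y z hx hx' hy hy' hz (by omega) (by omega)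
  · exact h y x z hy hy' hx hx' hz (by omega) (by omega)

/-- A position whose value lies between two values of the left piece stays in the whole interval,
and cannot be in the right piece, whose signed values are all larger. -/
theorem CommonInt.left_of_splitsAt {a b c : ℕ} {s : Sgn} (h : CommonInt f m a b)
    (hac : a < c) (hcb : c ≤ b) (hs : SplitsAt f s a c b) : CommonInt f m a c := by
  refine commonInt_of_signedVal s hac (hcb.trans h.2.1) fun x y z hx hx' hy hy' hz h₁ h₂ => ?_
  have := h.mem s hx (by omega) hy (by omega) hz h₁ h₂
  by_contra hc
  have := hs y z hy hy' (by omega) this.2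
  omega

theorem CommonInt.right_of_splitsAt {a b c : ℕ} {s : Sgn} (h : CommonInt f m a b)
    (hac : a ≤ c) (hcb : c < b) (hs : SplitsAt f s a c b) : CommonInt f m c b := by
  refine commonInt_of_signedVal s hcb h.2.1 fun x y z hx hx' hy hy' hz h₁ h₂ => ?_
  have := h.mem s (by omega) hx' (by omega) hy' hz h₁ h₂
  by_contra hc
  have := hs z x this.1 (by omega) hx hx'
  omega

/-- Both pieces of a split common interval are again common intervals, so the hypothesis applies
recursively. -/
theorem exists_separates_of_splits
    (h : ∀ a b, CommonInt f m a b → a + 1 < b → Splits f a b) :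
    ∀ a b, CommonInt f m a b → ∃ T, Separates f T a b := by
  have key : ∀ N a b, b - a ≤ N → CommonInt f m a b → ∃ T, Separates f T a b := by
    intro N
    induction N with
    | zero => intro a b hN hab; have := hab.1; omega
    | succ N ih =>
      intro a b hN hab
      by_cases h1 : a + 1 < b
      · obtain ⟨s, c, hac, hcb, hs⟩ := h a b hab h1
        obtain ⟨l, hl⟩ := ih a c (by omega) (hab.left_of_splitsAt hac hcb.le hs)
        obtain ⟨r, hr⟩ := ih c b (by omega) (hab.right_of_splitsAt hac.le hcb hs)
        exact ⟨_, .node s l r a c b hl hr hs⟩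
      · obtain rfl : b = a + 1 := by have := hab.1; omega
        exact ⟨_, .leaf a⟩
  exact fun a b => key (b - a) a b le_rfl

theorem Separates.lt {T : BinTree} {a b : ℕ} (h : Separates f T a b) : a < b := by
  induction h with
  | leaf => omega
  | node => omega

/-- An occurrence straddling the root cut would inherit a direct or skew decomposition, which
neither 3142 nor 2413 has. -/
theorem Separates.avoids {T : BinTree} {a b : ℕ} (h : Separates f T a b) : Avoids f a b := by
  induction h with
  | leaf => intro s p q r t; omega
  | node s l r a c b hl hr hs ihl ihr =>
    intro s' p q r t hp hpq hqr hrt ht h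
    by_cases h1 : t < c
    · exact ihl s' p q r t hp hpq hqr hrt h1 h
    by_cases h2 : c ≤ p
    · exact ihr s' p q r t h2 hpq hqr hrt ht h
    have hpt := hs p t hp (by omega) (by omega) ht
    have hpq' : c ≤ q → _ := fun hc => hs p q hp (by omega) hc (by omega)
    have hpr : c ≤ r → _ := fun hc => hs p r hp (by omega) hc (by omega)
    have hqt : q < c → _ := fun hc => hs q t (by omega) hc (by omega) (by omega)
    have hqr' : q < c → c ≤ r → _ := fun hc hc' => hs q r (by omega) hc hc' (by omega)
    have hrt' : r < c → _ := fun hc => hs r t (by omega) hc (by omega) (by omega)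
    by_cases hss : s' = s
    · subst hss
      omega
    · simp only [signedVal_of_ne hss] at h
      omega

theorem Avoids.mono {a b a' b' : ℕ} (h : Avoids f a b) (ha : a ≤ a') (hb : b' ≤ b) :
    Avoids f a' b' :=
  fun s p q r t hp hpq hqr hrt ht => h s p q r t (by omega) hpq hqr hrt (by omega)

/-- Induction on the right end. The window without its last entry splits; take the leftmost cut `c`
of its sign `s`. In signed values, if the last entry is above the left piece, the cut survives; if
it is below, it is below everything and is cut off alone with the other sign. Otherwise it falls
inside the values of the left piece, and splitting that piece yields a forbidden pattern. -/
theorem Avoids.splits (hf : Function.Injective f) {a b : ℕ} (h : Avoids f a b)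
    (hab : a + 1 < b) : Splits f a b := by
  classical
  induction b using Nat.strong_induction_on with
  | _ b ih =>
    obtain ⟨b, rfl⟩ : ∃ b', b = b' + 1 := ⟨b - 1, by omega⟩
    by_cases h2 : a + 1 = b
    · subst h2
      rcases lt_or_gt_of_ne (hf.ne (show a ≠ a + 1 by omega)) with hlt | hlt
      · refine ⟨.plus, a + 1, by omega, by omega, fun x y _ _ _ _ => ?_⟩
        obtain rfl : x = a := by omega
        obtain rfl : y = x + 1 := by omega
        simpa [signedVal] using hlt
      · refine ⟨.minus, a + 1, by omega, by omega, fun x y _ _ _ _ => ?_⟩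
        obtain rfl : x = a := by omega
        obtain rfl : y = x + 1 := by omega
        simpa [signedVal] using hlt
    · have hsp := ih b (by omega) (h.mono le_rfl (by omega)) (by omega)
      obtain ⟨s, hc⟩ := hsp
      have hmin := Nat.find_spec hc
      have hmin' := fun k => @Nat.find_min _ _ hc k
      generalize Nat.find hc = c at hmin hmin'
      obtain ⟨hac, hcb, hs⟩ := hmin
      by_cases hA : ∀ x, a ≤ x → x < c → signedVal f s x < signedVal f s b
      · refine ⟨s, c, hac, by omega, fun x y hx hx' hy hy' => ?_⟩
        by_cases hyb : y = b
        · subst hyb; exact hA x hx hx'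
        · exact hs x y hx hx' hy (by omega)
      by_cases hB : ∀ x, a ≤ x → x < c → signedVal f s b < signedVal f s x
      · obtain ⟨s', hs'⟩ : ∃ s', s' ≠ s := by
          cases s
          · exact ⟨.minus, by simp⟩
          · exact ⟨.plus, by simp⟩
        refine ⟨s', b, by omega, by omega, fun x y hx hx' hy hy' => ?_⟩
        obtain rfl : y = b := by omega
        rw [signedVal_of_ne hs', signedVal_of_ne hs']
        by_cases hxc : x < c
        · have := hB x hx hxc
          omega
        · have := hB a le_rfl hac
          have := hs a x le_rfl hac (by omega) hx'
          omega
      push Not at hA hB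
      obtain ⟨y, hy, hy', hyb⟩ := hA
      obtain ⟨x, hx, hx', hxb⟩ := hB
      have hyne := (signedVal_injective hf s).ne (show y ≠ b by omega)
      have hxne := (signedVal_injective hf s).ne (show x ≠ b by omega)
      -- Two distinct positions left of `c` make that piece long enough for the induction
      -- hypothesis.
      have hxy : x ≠ y := by rintro rfl; omega
      obtain ⟨s', d, had, hdc, hd⟩ := ih c (by omega) (h.mono le_rfl (by omega)) (by omega)
      exfalso
      by_cases hss : s' = s
      · subst hss
        -- A cut of the same sign at `d < c` would extend to the whole prefix, against the
        -- minimality of `c`.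
        refine hmin' d hdc ⟨had, by omega, fun u v hu hu' hv hv' => ?_⟩
        by_cases hvc : v < c
        · exact hd u v hu hu' hv hvc
        · exact hs u v hu (by omega) (by omega) hv'
      · have hd' : ∀ u v, a ≤ u → u < d → d ≤ v → v < c →
            signedVal f s v < signedVal f s u := by
          intro u v hu hu' hv hv'
          have := hd u v hu hu' hv hv'
          rw [signedVal_of_ne hss, signedVal_of_ne hss] at this
          omega
        -- In signed values `[a, d)` lies above `[d, c)`, so a witness on the wrong side of `d` may
        -- be replaced by `a` here and by `d` below. Then `p, q, c, b` form the pattern.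
        have hp : ∃ p, a ≤ p ∧ p < d ∧ signedVal f s b < signedVal f s p := by
          by_cases hyd : y < d
          · exact ⟨y, hy, hyd, by omega⟩
          · exact ⟨a, le_rfl, had, by have := hd' a y le_rfl had (by omega) hy'; omega⟩
        have hq : ∃ q, d ≤ q ∧ q < c ∧ signedVal f s q < signedVal f s b := by
          by_cases hxd : d ≤ x
          · exact ⟨x, hxd, hx', by omega⟩
          · exact ⟨d, le_rfl, hdc, by have := hd' x d hx (by omega) le_rfl hdc; omega⟩
        obtain ⟨p, hp1, hp2, hp3⟩ := hp
        obtain ⟨q, hq1, hq2, hq3⟩ := hq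
        exact h s p q c b hp1 (by omega) hq2 hcb (by omega)
          ⟨hq3, hp3, hs p c hp1 (by omega) le_rfl hcb⟩

/-! ### Common intervals -/

/-- The shared position `c` is a pivot: a value between those of `x` and `y` lies between one of
them and `f c`, or equals `f c`. -/
theorem CommonInt.union (hf : Function.Injective f) {a b c d : ℕ} (h : CommonInt f m a b)
    (h' : CommonInt f m c d) (hac : a ≤ c) (hcb : c < b) (hbd : b ≤ d) :
    CommonInt f m a d := by
  refine ⟨by omega, h'.2.1, fun x y z hx hx' hy hy' hz h₁ h₂ => ?_⟩
  have k1 := h.2.2 x c z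
  have k2 := h'.2.2 x c z
  have k3 := h.2.2 c y z
  have k4 := h'.2.2 c y z
  by_cases hzc : z = c
  · omega
  · have := hf.ne hzc
    omega

/-- Suppose `z` in the intersection had a value between those of `x, y < c`. The value at `b`,
outside the first interval, is not between them, so `f x` or `f y` lies between `f b` and `f z`,
forcing `x` or `y` into the second interval. -/
theorem CommonInt.left_diff (hf : Function.Injective f) {a b c d : ℕ} (h : CommonInt f m a b)
    (h' : CommonInt f m c d) (hac : a < c) (hcb : c ≤ b) (hbd : b < d) :
    CommonInt f m a c := by
  refine ⟨hac, by have := h.2.1; omega, fun x y z hx hx' hy hy' hz h₁ h₂ => ?_⟩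
  have k := h.2.2 x y z hx (by omega) hy (by omega) hz h₁ h₂
  by_contra hcon
  have hd := h'.2.1
  have k1 := h.2.2 x y b hx (by omega) hy (by omega) (by omega)
  have k2 := h'.2.2 b z x (by omega) hbd (by omega) (by omega) (by omega)
  have k3 := h'.2.2 z b y (by omega) (by omega) (by omega) hbd (by omega)
  have := hf.ne (show x ≠ b by omega)
  have := hf.ne (show y ≠ b by omega)
  omega

theorem CommonInt.right_diff (hf : Function.Injective f) {a b c d : ℕ} (h : CommonInt f m a b)
    (h' : CommonInt f m c d) (hac : a < c) (hcb : c ≤ b) (hbd : b < d) :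
    CommonInt f m b d := by
  refine ⟨hbd, h'.2.1, fun x y z hx hx' hy hy' hz h₁ h₂ => ?_⟩
  have k := h'.2.2 x y z (by omega) hx' (by omega) hy' hz h₁ h₂
  by_contra hcon
  have hd := h'.2.1
  have k1 := h'.2.2 x y a (by omega) hx' (by omega) hy' (by omega)
  have k2 := h.2.2 a z x (by omega) (by omega) (by omega) (by omega) (by omega)
  have k3 := h.2.2 z a y (by omega) (by omega) (by omega) (by omega) (by omega)
  have := hf.ne (show x ≠ a by omega)
  have := hf.ne (show y ≠ a by omega)
  omega

theorem CommonInt.inter {a b c d : ℕ} (h : CommonInt f m a b)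
    (h' : CommonInt f m c d) (hac : a ≤ c) (hcb : c < b) (hbd : b ≤ d) :
    CommonInt f m c b := by
  refine ⟨hcb, h.2.1, fun x y z hx hx' hy hy' hz h₁ h₂ => ?_⟩
  have k := h.2.2 x y z (by omega) hx' (by omega) hy' hz h₁ h₂
  have k' := h'.2.2 x y z (by omega) (by omega) (by omega) (by omega) hz h₁ h₂
  omega

theorem splitsAt_plus_of_commonInt {a b c : ℕ} (h : CommonInt f m a c) (h' : CommonInt f m c b)
    (hf : Function.Injective f) (hlt : f a < f c) : SplitsAt f .plus a c b := by
  intro x y hx hx' hy hy'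
  simp only [signedVal, Nat.cast_lt]
  by_contra hcon
  have hb := h'.2.1
  have h0 := h.1
  have h1 := h'.1
  have hxy := hf.ne (show x ≠ y by omega)
  have hxc := hf.ne (show x ≠ c by omega)
  have k1 := h'.2.2 y c x hy hy' le_rfl h1 (by omega)
  have k2 := h.2.2 a x c le_rfl h0 hx hx' (by omega)
  omega

theorem splitsAt_minus_of_commonInt {a b c : ℕ} (h : CommonInt f m a c) (h' : CommonInt f m c b)
    (hf : Function.Injective f) (hlt : f c < f a) : SplitsAt f .minus a c b := by
  intro x y hx hx' hy hy'
  simp only [signedVal, neg_lt_neg_iff, Nat.cast_lt]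
  by_contra hcon
  have hb := h'.2.1
  have h0 := h.1
  have h1 := h'.1
  have hxy := hf.ne (show x ≠ y by omega)
  have hxc := hf.ne (show x ≠ c by omega)
  have k1 := h'.2.2 c y x le_rfl h1 hy hy' (by omega)
  have k2 := h.2.2 x a c hx hx' le_rfl h0 (by omega)
  omega

theorem splits_of_commonInt {a b c : ℕ} (h : CommonInt f m a c) (h' : CommonInt f m c b)
    (hf : Function.Injective f) : Splits f a b := by
  have h0 := h.1
  rcases lt_or_gt_of_ne (hf.ne (show a ≠ c by omega)) with hlt | hlt
  · exact ⟨.plus, c, h.1, h'.1, splitsAt_plus_of_commonInt h h' hf hlt⟩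
  · exact ⟨.minus, c, h.1, h'.1, splitsAt_minus_of_commonInt h h' hf hlt⟩

/-- An overlapping common interval cuts this one into difference and intersection, two adjacent
common intervals. -/
theorem CommonInt.splits_of_not_strongInt (hf : Function.Injective f) {a b : ℕ}
    (h : CommonInt f m a b) (hs : ¬ StrongInt f m a b) : Splits f a b := by
  simp only [StrongInt, h, true_and] at hs
  push Not at hs
  obtain ⟨c, d, hcd, ho | ho⟩ := hs
  · exact splits_of_commonInt (h.left_diff hf hcd ho.1 ho.2.1.le ho.2.2)
      (h.inter hcd ho.1.le ho.2.1 ho.2.2.le) hf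
  · exact splits_of_commonInt (hcd.inter h ho.1.le ho.2.1 ho.2.2.le)
      (hcd.right_diff hf h ho.1 ho.2.1.le ho.2.2) hf

theorem strongInt_singleton {a : ℕ} (ha : a < m) : StrongInt f m a (a + 1) := by
  refine ⟨⟨by omega, ha, fun x y z hx hx' hy hy' hz h₁ h₂ => ?_⟩, fun c d h => ?_⟩
  · obtain rfl : x = a := by omega
    obtain rfl : y = x := by omega
    omega
  · unfold NatOverlap
    omega

theorem strongInt_univ (hm : 0 < m) : StrongInt f m 0 m := by
  refine ⟨⟨hm, le_rfl, fun x y z _ _ _ _ hz _ _ => by omega⟩, fun c d h => ?_⟩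
  have := h.2.1
  unfold NatOverlap
  omega

/-- A strong interval that is no singleton splits if it properly contains a common interval that
no proper strong subinterval contains. -/
theorem StrongInt.splits_of_maximal (hf : Function.Injective f) {a b u v : ℕ}
    (h : StrongInt f m a b) (huv : CommonInt f m u v) (hau : a ≤ u) (hvb : v ≤ b)
    (hne : a < u ∨ v < b)
    (hK : ∀ p q, StrongInt f m p q → a ≤ p → p ≤ u → v ≤ q → q ≤ b → a < p ∨ q < b → False) :
    Splits f a b := by
  -- Enlarge `[u, v)`: it is not strong, so it overlaps a common interval, which stays inside the
  -- strong `[a, b)`. Replace it by the union until the union is all of `[a, b)`; then `[u, v)` and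
  -- the difference give the cut.
  have key : ∀ N u v, (b - a) - (v - u) ≤ N → CommonInt f m u v → a ≤ u → v ≤ b →
      (a < u ∨ v < b) →
      (∀ p q, StrongInt f m p q → a ≤ p → p ≤ u → v ≤ q → q ≤ b → a < p ∨ q < b → False) →
      Splits f a b := by
    intro N
    induction N with
    | zero => intro u v hN huv; have := huv.1; omega
    | succ N ih =>
      intro u v hN huv hau hvb hne hK
      have hns : ¬ StrongInt f m u v := fun hs => hK u v hs hau le_rfl le_rfl hvb hne
      simp only [StrongInt, huv, true_and] at hns
      push Not at hns
      obtain ⟨c, d, hcd, ho⟩ := hns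
      have hno := h.2 c d hcd
      have huv' := huv.1
      unfold NatOverlap at hno
      rcases ho with ho | ho
      · have hd : d ≤ b := by omega
        by_cases hI : a < u ∨ d < b
        · exact ih u d (by omega) (huv.union hf hcd ho.1.le ho.2.1 ho.2.2.le) hau hd hI
            fun p q hpq h1 h2 h3 => hK p q hpq h1 h2 (by omega)
        · obtain rfl : u = a := by omega
          obtain rfl : d = b := by omega
          exact splits_of_commonInt huv (huv.right_diff hf hcd ho.1 ho.2.1.le ho.2.2) hf
      · have hc : a ≤ c := by omega
        by_cases hI : a < c ∨ v < b
        · exact ih c v (by omega) (hcd.union hf huv ho.1.le ho.2.1 ho.2.2.le) hc hvb hI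
            fun p q hpq h1 h2 h3 => hK p q hpq h1 (by omega) h3
        · obtain rfl : c = a := by omega
          obtain rfl : v = b := by omega
          exact splits_of_commonInt (hcd.left_diff hf huv ho.1 ho.2.1.le ho.2.2) huv hf
  exact key _ u v le_rfl huv hau hvb hne hK

/-! ### The vertices below a maximal connected set of vertices of the same sign -/

/-- `[p, q)` is the window below a subtree `T'` of a separating tree of `[a, b)`, and is cut off
from the rest of `[a, b)` in the direction of `s`. -/
structure IsPart (f : ℕ → ℕ) (s : Sgn) (a b : ℕ) (T' : BinTree) (p q : ℕ) : Prop where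
  separates : Separates f T' p q
  le : a ≤ p
  le' : q ≤ b
  split : SplitsAt f s a p b
  split' : SplitsAt f s a q b
  ne : ∀ l r, T' ≠ .node s l r

/-- The parts are the subtrees that become siblings after contraction. Nested cuts of the same sign
are cuts of the whole window; at a leaf or a root of the other sign, the tree itself is the only
part. -/
theorem exists_parts (s : Sgn) {T : BinTree} {a b : ℕ} (h : Separates f T a b) :
    ∃ L : List (BinTree × ℕ × ℕ),
      absorb s (contract T) = L.map (fun e => contract e.1) ∧
      (∀ e ∈ L, IsPart f s a b e.1 e.2.1 e.2.2) ∧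
      L.Pairwise (fun e e' => e.2.2 ≤ e'.2.1) ∧
      (∀ x, a ≤ x → x < b → ∃ e ∈ L, e.2.1 ≤ x ∧ x < e.2.2) ∧
      ((∃ l r, T = .node s l r) → ∀ e ∈ L, e.2.2 - e.2.1 < b - a) := by
  induction h with
  | leaf a =>
    refine ⟨[(.leaf, a, a + 1)], by simp [contract, absorb], ?_, by simp, ?_, by simp⟩
    · simp only [List.mem_singleton, forall_eq]
      exact ⟨.leaf a, le_rfl, le_rfl, fun x y => by omega, fun x y => by omega, by simp⟩
    · exact fun x hx hx' => ⟨_, List.mem_singleton_self _, hx, hx'⟩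
  | node s' l r a c b hl hr hs ihl ihr =>
    have hlc := hl.lt
    have hrc := hr.lt
    by_cases hss : s' = s
    · subst hss
      obtain ⟨Ll, hl1, hl2, hl3, hl4, -⟩ := ihl
      obtain ⟨Lr, hr1, hr2, hr3, hr4, -⟩ := ihr
      refine ⟨Ll ++ Lr, by rw [List.map_append, ← hl1, ← hr1]; simp only [contract, absorb.eq_1, if_true], ?_, ?_, ?_, ?_⟩
      · intro e he
        rcases List.mem_append.1 he with he | he
        · obtain ⟨h1, h2, h3, h4, h5, h6⟩ := hl2 e he
          have h7 := h1.lt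
          refine ⟨h1, h2, by omega, fun x y hx hx' hy hy' => ?_,
            fun x y hx hx' hy hy' => ?_, h6⟩
          · by_cases hyc : y < c
            · exact h4 x y hx hx' hy hyc
            · exact hs x y hx (by omega) (by omega) hy'
          · by_cases hyc : y < c
            · exact h5 x y hx hx' hy hyc
            · exact hs x y hx (by omega) (by omega) hy'
        · obtain ⟨h1, h2, h3, h4, h5, h6⟩ := hr2 e he
          have h7 := h1.lt
          refine ⟨h1, by omega, h3, fun x y hx hx' hy hy' => ?_,
            fun x y hx hx' hy hy' => ?_, h6⟩
          · by_cases hxc : x < c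
            · exact hs x y hx hxc (by omega) hy'
            · exact h4 x y (by omega) hx' hy hy'
          · by_cases hxc : x < c
            · exact hs x y hx hxc (by omega) hy'
            · exact h5 x y (by omega) hx' hy hy'
      · rw [List.pairwise_append]
        refine ⟨hl3, hr3, fun e he e' he' => ?_⟩
        have := (hl2 e he).le'
        have := (hr2 e' he').le
        omega
      · intro x hx hx'
        by_cases hxc : x < c
        · obtain ⟨e, he, h⟩ := hl4 x hx hxc
          exact ⟨e, List.mem_append_left _ he, h⟩
        · obtain ⟨e, he, h⟩ := hr4 x (by omega) hx'
          exact ⟨e, List.mem_append_right _ he, h⟩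
      · intro _ e he
        rcases List.mem_append.1 he with he | he
        · have := (hl2 e he).le'
          have := (hl2 e he).le
          omega
        · have := (hr2 e he).le'
          have := (hr2 e he).le
          omega
    · refine ⟨[(.node s' l r, a, b)], by simp [contract, absorb, hss], ?_, by simp, ?_, ?_⟩
      · simp only [List.mem_singleton, forall_eq]
        exact ⟨.node s' l r a c b hl hr hs, le_rfl, le_rfl, fun x y => by omega,
          fun x y => by omega, by simp [hss]⟩
      · exact fun x hx hx' => ⟨_, List.mem_singleton_self _, hx, hx'⟩
      · rintro ⟨l', r', h⟩
        simp [hss] at h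

theorem IsPart.lt {s : Sgn} {a b p q : ℕ} {T : BinTree} (h : IsPart f s a b T p q) : p < q :=
  h.separates.lt

theorem IsPart.commonInt {s : Sgn} {a b p q : ℕ} {T : BinTree} (h : IsPart f s a b T p q)
    (hab : CommonInt f m a b) : CommonInt f m p q := by
  have h1 := h.lt
  have h2 := h.le
  have h3 := h.le'
  refine (hab.left_of_splitsAt (c := q) (by omega) h3 h.split').right_of_splitsAt h2 h1
    (s := s) fun x y hx hx' hy hy' => h.split x y hx hx' hy (by omega)

/-- A common interval overlapping `[p, q)` stays inside `[a, b)`. If it leaves on the right, it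
contains `q - 1` and `q`; the root of the part has the opposite sign, so the value at `p` lies
between theirs and `p` is forced in. On the left, `p - 1` and `p` force in `q - 1`. -/
theorem IsPart.strongInt {s : Sgn} {a b p q : ℕ} {T : BinTree} (h : IsPart f s a b T p q)
    (hab : StrongInt f m a b) : StrongInt f m p q := by
  refine ⟨h.commonInt hab.1, fun u v huv ho => ?_⟩
  have hno := hab.2 u v huv
  have h2 := h.le
  have h3 := h.le'
  have hu := huv.1
  have hv := huv.2.1
  have hb := hab.1.2.1
  obtain ⟨hsep, -, -, hs, hs', hne⟩ := h
  cases hsep with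
  | leaf => unfold NatOverlap at ho; omega
  | node s' l r _ c _ hl hr hc =>
    have hss : s' ≠ s := by rintro rfl; exact hne l r rfl
    have hlc := hl.lt
    have hrc := hr.lt
    have k1 := hc p (q - 1) le_rfl hlc (by omega) (by omega)
    rw [signedVal_of_ne hss, signedVal_of_ne hss] at k1
    unfold NatOverlap at ho hno
    rcases ho with ho | ho
    · have k2 := hs' p q h2 (by omega) le_rfl (by omega)
      have := huv.mem s (x := q - 1) (y := q) (z := p) (by omega) (by omega) (by omega) (by omega)
        (by omega) (by omega) k2
      omega
    · have k2 := hs (p - 1) (q - 1) (by omega) (by omega) (by omega) (by omega)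
      have := huv.mem s (x := p - 1) (y := p) (z := q - 1) (by omega) (by omega) (by omega)
        (by omega) (by omega) k2 (by omega)
      omega

/-- The windows `[a, p)`, `[a, q)`, `[p, b)`, `[q, b)` are common intervals when nonempty, and a
proper strong interval strictly larger than the part would overlap one of them. -/
theorem IsPart.eq_of_strongInt {s : Sgn} {a b p q u v : ℕ} {T : BinTree}
    (h : IsPart f s a b T p q) (hab : CommonInt f m a b) (huv : StrongInt f m u v)
    (hau : a ≤ u) (hup : u ≤ p) (hqv : q ≤ v) (hvb : v ≤ b) (hne : a < u ∨ v < b) :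
    u = p ∧ v = q := by
  have h1 := h.lt
  by_contra hcon
  have hl1 : a < p → CommonInt f m a p := fun hp =>
    hab.left_of_splitsAt hp (by omega) h.split
  have hl2 : CommonInt f m a q := hab.left_of_splitsAt (by omega) (by omega) h.split'
  have hr1 : q < b → CommonInt f m q b := fun hp =>
    hab.right_of_splitsAt (by omega) hp h.split'
  have hr2 : CommonInt f m p b := hab.right_of_splitsAt (by omega) (by omega) h.split
  have k1 := fun hp => huv.2 _ _ (hl1 hp)
  have k2 := huv.2 _ _ hl2
  have k3 := fun hp => huv.2 _ _ (hr1 hp)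
  have k4 := huv.2 _ _ hr2
  unfold NatOverlap at *
  omega

end SepPerm

namespace SepPerm
variable {f : ℕ → ℕ} {m : ℕ}

/-! ### The word of a permutation -/

/-- The one-line notation of `σ`, continued by the identity. -/
def word (σ : Equiv.Perm (Fin m)) (x : ℕ) : ℕ := if h : x < m then σ ⟨x, h⟩ else x

theorem word_apply (σ : Equiv.Perm (Fin m)) (x : Fin m) : word σ x = σ x := by
  simp [word]

theorem word_lt_iff (σ : Equiv.Perm (Fin m)) (x : ℕ) : word σ x < m ↔ x < m := by
  unfold word
  split <;> simp_all

theorem word_injective (σ : Equiv.Perm (Fin m)) : Function.Injective (word σ) := by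
  intro x y h
  have hx := word_lt_iff σ x
  have hy := word_lt_iff σ y
  by_cases hxm : x < m
  · have hym : y < m := by omega
    have := word_apply σ ⟨x, hxm⟩
    have h2 := word_apply σ ⟨y, hym⟩
    simp only at this h2
    rw [this, h2, Fin.val_inj, σ.injective.eq_iff, Fin.mk.injEq] at h
    exact h
  · have hym : ¬ y < m := by omega
    simpa [word, hxm, hym] using h

theorem word_surjective (σ : Equiv.Perm (Fin m)) : Function.Surjective (word σ) := by
  intro y
  by_cases hy : y < m
  · exact ⟨σ.symm ⟨y, hy⟩, by rw [word_apply]; simp⟩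
  · exact ⟨y, by simp [word, hy]⟩

theorem ofFn_eq_map_word (σ : Equiv.Perm (Fin m)) :
    (List.ofFn fun k => (σ k : ℕ)) = (List.range' 0 m).map (word σ) := by
  apply List.ext_getElem
  · simp
  · intro k h1 h2
    have hk : k < m := by simpa using h1
    simp [word, hk]

/-! ### Separating trees in terms of positions -/

theorem Decorates.lt {T : BinTree} {w : List ℕ} {i j : ℕ} (h : Decorates T w i j) : i < j := by
  induction h with
  | leaf => omega
  | plus => omega
  | minus => omega

theorem map_range'_append {u v : List ℕ} {a : ℕ}
    (h : u ++ v = (List.range' a (u ++ v).length).map f) :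
    u = (List.range' a u.length).map f ∧ v = (List.range' (a + u.length) v.length).map f := by
  rw [List.length_append, ← List.range'_append_1, List.map_append] at h
  exact List.append_inj h (by simp)

/-- The bounds on the values are carried through the induction because they make the two halves
comparable at the threshold `h`. -/
theorem Decorates.separates {T : BinTree} {w : List ℕ} {i j : ℕ} (h : Decorates T w i j) :
    ∀ a, w = (List.range' a w.length).map f → Separates f T a (a + w.length) ∧
      ∀ x, a ≤ x → x < a + w.length → i ≤ f x ∧ f x < j := by
  induction h with
  | leaf i =>
    intro a h
    simp only [List.length_singleton, List.range'_one, List.map_cons, List.map_nil,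
      List.cons.injEq, and_true] at h
    refine ⟨.leaf a, fun x hx hx' => ?_⟩
    obtain rfl : x = a := by simp at hx'; omega
    omega
  | plus l r u v i h j hl hr ihl ihr =>
    intro a hw
    obtain ⟨hu, hv⟩ := map_range'_append hw
    obtain ⟨hul, hu⟩ := ihl a hu
    obtain ⟨hvl, hv⟩ := ihr _ hv
    have h1 := hl.lt
    have h2 := hr.lt
    rw [List.length_append, ← add_assoc]
    refine ⟨.node _ l r a _ _ hul hvl fun x y hx hx' hy hy' => ?_, fun x hx hx' => ?_⟩
    · have := hu x hx hx'
      have := hv y hy hy'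
      simp only [signedVal]
      omega
    · have := hu x hx
      have := hv x
      omega
  | minus l r u v i h j hl hr ihl ihr =>
    intro a hw
    obtain ⟨hu, hv⟩ := map_range'_append hw
    obtain ⟨hul, hu⟩ := ihl a hu
    obtain ⟨hvl, hv⟩ := ihr _ hv
    have h1 := hl.lt
    have h2 := hr.lt
    rw [List.length_append, ← add_assoc]
    refine ⟨.node _ l r a _ _ hul hvl fun x y hx hx' hy hy' => ?_, fun x hx hx' => ?_⟩
    · have := hu x hx hx'
      have := hv y hy hy'
      simp only [signedVal]
      omega
    · have := hu x hx
      have := hv x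
      omega

theorem exists_min_position {c b : ℕ} (f : ℕ → ℕ) (h : c < b) :
    ∃ y, c ≤ y ∧ y < b ∧ ∀ x, c ≤ x → x < b → f y ≤ f x := by
  obtain ⟨y, hy, hmin⟩ := (Finset.Ico c b).exists_min_image f ⟨c, by simpa using h⟩
  rw [Finset.mem_Ico] at hy
  exact ⟨y, hy.1, hy.2, fun x hx hx' => hmin x (Finset.mem_Ico.2 ⟨hx, hx'⟩)⟩

theorem Separates.decorates (hf : Function.Surjective f) {T : BinTree} {a b : ℕ}
    (h : Separates f T a b) : ∀ i j, (∀ x, (a ≤ x ∧ x < b) ↔ (i ≤ f x ∧ f x < j)) →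
      Decorates T ((List.range' a (b - a)).map f) i j := by
  induction h with
  | leaf a =>
    intro i j h
    have h0 := (h a).1 (by omega)
    -- Surjectivity gives positions for the extreme values `i` and `j - 1`; both must be the leaf,
    -- so `j = i + 1`.
    obtain ⟨x, hx⟩ := hf i
    obtain ⟨y, hy⟩ := hf (j - 1)
    have h1 := (h x).2 (by omega)
    have h2 := (h y).2 (by omega)
    obtain rfl : x = a := by omega
    obtain rfl : y = x := by omega
    obtain rfl : j = i + 1 := by omega
    simp only [Nat.add_sub_cancel_left, List.range'_one, List.map_cons, List.map_nil, hx]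
    exact .leaf i
  | node s l r a c b hl hr hs ihl ihr =>
    intro i j h
    have hlc := hl.lt
    have hrc := hr.lt
    have hsplit : (List.range' a (b - a)).map f =
        (List.range' a (c - a)).map f ++ (List.range' c (b - c)).map f := by
      rw [← List.map_append, show b - a = (c - a) + (b - c) by omega, ← List.range'_append_1,
        Nat.add_sub_cancel' hlc.le]
    rw [hsplit]
    cases s with
    | plus =>
      simp only [SplitsAt, signedVal, Nat.cast_lt] at hs
      -- The threshold is the smallest value in the upper half, which is the right one for `+`.
      obtain ⟨y, hy, hy', hmin⟩ := exists_min_position f hrc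
      have hyij := (h y).1 (by omega)
      refine .plus l r _ _ i (f y) j (ihl _ _ fun x => ?_) (ihr _ _ fun x => ?_)
      · have h1 := h x
        have h2 := hs x y
        have h3 := hmin x
        omega
      · have h1 := h x
        have h2 := hs x y
        have h3 := hmin x
        omega
    | minus =>
      simp only [SplitsAt, signedVal, neg_lt_neg_iff, Nat.cast_lt] at hs
      obtain ⟨y, hy, hy', hmin⟩ := exists_min_position f hlc
      have hyij := (h y).1 (by omega)
      refine .minus l r _ _ i (f y) j (ihl _ _ fun x => ?_) (ihr _ _ fun x => ?_)
      · have h1 := h x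
        have h2 := hs y x
        have h3 := hmin x
        omega
      · have h1 := h x
        have h2 := hs y x
        have h3 := hmin x
        omega

theorem isBinarySeparatingTree_iff (σ : Equiv.Perm (Fin m)) (T : BinTree) :
    IsBinarySeparatingTree σ T ↔ Separates (word σ) T 0 m := by
  unfold IsBinarySeparatingTree
  rw [ofFn_eq_map_word]
  constructor
  · intro h
    simpa using (h.separates (f := word σ) 0 (by simp)).1
  · intro h
    exact h.decorates (word_surjective σ) 0 m fun x => by
      have := word_lt_iff σ x
      omega

/-! ### Patterns -/

/-- Reversing the values of 2413 gives 3142, so one chain of signed inequalities describes both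
patterns. -/
theorem isSeparable_iff (σ : Equiv.Perm (Fin m)) : IsSeparable σ ↔ Avoids (word σ) 0 m := by
  constructor
  · rintro ⟨h1, h2⟩ s p q r t - hpq hqr hrt ht
    lift p to Fin m using (by omega)
    lift q to Fin m using (by omega)
    lift r to Fin m using (by omega)
    lift t to Fin m using ht
    rw [Fin.val_fin_lt] at hpq hqr hrt
    have hmono : StrictMono ![p, q, r, t] := by
      rw [Fin.strictMono_iff_lt_succ]
      intro i
      fin_cases i <;> simpa
    rintro ⟨k1, k2, k3⟩
    cases s with
    | plus =>
      simp only [signedVal, word_apply, Nat.cast_lt, Fin.val_fin_lt] at k1 k2 k3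
      refine h1 ⟨_, hmono, fun i j hij => ?_⟩
      fin_cases i <;> fin_cases j <;> simp [perm3142] at hij ⊢ <;> order
    | minus =>
      simp only [signedVal, word_apply, neg_lt_neg_iff, Nat.cast_lt, Fin.val_fin_lt] at k1 k2 k3
      refine h2 ⟨_, hmono, fun i j hij => ?_⟩
      fin_cases i <;> fin_cases j <;> simp [perm2413] at hij ⊢ <;> order
  · intro h
    constructor
    · rintro ⟨g, hg, hσ⟩
      refine h .plus (g 0) (g 1) (g 2) (g 3) (Nat.zero_le _) (hg (by decide)) (hg (by decide))
        (hg (by decide)) (g 3).2 ?_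
      simp only [signedVal, word_apply, Nat.cast_lt, Fin.val_fin_lt]
      exact ⟨hσ _ _ (by decide), hσ _ _ (by decide), hσ _ _ (by decide)⟩
    · rintro ⟨g, hg, hσ⟩
      refine h .minus (g 0) (g 1) (g 2) (g 3) (Nat.zero_le _) (hg (by decide)) (hg (by decide))
        (hg (by decide)) (g 3).2 ?_
      simp only [signedVal, word_apply, neg_lt_neg_iff, Nat.cast_lt, Fin.val_fin_lt]
      exact ⟨hσ _ _ (by decide), hσ _ _ (by decide), hσ _ _ (by decide)⟩

/-! ### Blocks -/

variable {σ : Equiv.Perm (Fin m)}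

theorem isCommonInterval_iff (I : Block m) :
    IsCommonInterval σ I ↔ CommonInt (word σ) m I.1 (I.2 + 1) := by
  unfold IsCommonInterval CommonInt
  rw [Set.ordConnected_iff]
  constructor
  · rintro ⟨h1, h2⟩
    refine ⟨by omega, by omega, fun x y z hx hx' hy hy' hz hxz hzy => ?_⟩
    lift x to Fin m using by omega
    lift y to Fin m using by omega
    lift z to Fin m using hz
    rw [word_apply, word_apply, Fin.val_fin_lt] at hxz hzy
    have := h2 (σ x) ⟨x, ⟨by omega, by omega⟩, rfl⟩ (σ y) ⟨y, ⟨by omega, by omega⟩, rfl⟩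
      (hxz.trans hzy).le ⟨hxz.le, hzy.le⟩
    rw [σ.injective.mem_set_image] at this
    have h3 := this.1
    have h4 := this.2
    omega
  · rintro ⟨h1, h2, h3⟩
    refine ⟨by omega, ?_⟩
    rintro _ ⟨x, hx, rfl⟩ _ ⟨y, hy, rfl⟩ - w ⟨hw, hw'⟩
    obtain ⟨z, rfl⟩ := σ.surjective w
    rw [σ.injective.mem_set_image]
    -- `CommonInt` only concerns strictly intermediate values, so the end values are treated apart.
    rcases hw.eq_or_lt with he | hlt
    · rwa [← σ.injective he]
    rcases hw'.eq_or_lt with he | hlt'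
    · rwa [σ.injective he]
    have hx1 := hx.1
    have hx2 := hx.2
    have hy1 := hy.1
    have hy2 := hy.2
    have := h3 x y z (by omega) (by omega) (by omega) (by omega) z.2
      (by rw [word_apply, word_apply]; exact hlt) (by rw [word_apply, word_apply]; exact hlt')
    exact ⟨by omega, by omega⟩

theorem mem_positions {I : Block m} {x : Fin m} :
    x ∈ I.positions ↔ (I.1 : ℕ) ≤ x ∧ (x : ℕ) < I.2 + 1 := by
  rw [Block.positions, Set.mem_Icc]
  omega

theorem overlap_iff {I J : Block m} (hI : I.1 ≤ I.2) (hJ : J.1 ≤ J.2) :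
    Overlap I J ↔ NatOverlap I.1 (I.2 + 1) J.1 (J.2 + 1) := by
  unfold Overlap NatOverlap
  constructor
  · rintro ⟨⟨x, hx, hx'⟩, ⟨y, hy, hy'⟩, z, hz, hz'⟩
    rw [mem_positions] at *
    omega
  · rintro (h | h)
    · refine ⟨⟨I.1, ?_⟩, ⟨J.2, ?_⟩, ⟨J.1, ?_⟩⟩ <;>
        simp only [Set.mem_sdiff, Set.mem_inter_iff, mem_positions] <;> omega
    · refine ⟨⟨I.2, ?_⟩, ⟨J.1, ?_⟩, ⟨I.1, ?_⟩⟩ <;>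
        simp only [Set.mem_sdiff, Set.mem_inter_iff, mem_positions] <;> omega

/-- Every nonempty window of positions is a block. -/
theorem exists_block {a b : ℕ} (hab : a < b) (hb : b ≤ m) :
    ∃ I : Block m, (I.1 : ℕ) = a ∧ (I.2 : ℕ) + 1 = b :=
  ⟨(⟨a, by omega⟩, ⟨b - 1, by omega⟩), rfl, by simp only; omega⟩

theorem isStrongInterval_iff (I : Block m) :
    IsStrongInterval σ I ↔ StrongInt (word σ) m I.1 (I.2 + 1) := by
  unfold IsStrongInterval StrongInt
  rw [isCommonInterval_iff]
  refine and_congr_right fun hI => ⟨fun h c d hcd => ?_, fun h J hJ => ?_⟩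
  · obtain ⟨J, rfl, rfl⟩ := exists_block hcd.1 hcd.2.1
    rw [← overlap_iff (by have := hI.1; omega) (by have := hcd.1; omega)]
    exact h J ((isCommonInterval_iff J).2 hcd)
  · rw [isCommonInterval_iff] at hJ
    rw [overlap_iff (by have := hI.1; omega) (by have := hJ.1; omega)]
    exact h _ _ hJ

theorem positions_subset_iff {I J : Block m} (hJ : J.1 ≤ J.2) :
    J.positions ⊆ I.positions ↔ I.1 ≤ J.1 ∧ J.2 ≤ I.2 :=
  Set.Icc_subset_Icc_iff hJ

theorem positions_ssubset_iff {I J : Block m} (hI : I.1 ≤ I.2) (hJ : J.1 ≤ J.2) :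
    J.positions ⊂ I.positions ↔ I.1 ≤ J.1 ∧ J.2 ≤ I.2 ∧ (I.1 < J.1 ∨ J.2 < I.2) := by
  rw [ssubset_iff_subset_not_subset, positions_subset_iff hI, positions_subset_iff hJ]
  omega

theorem IsStrongInterval.le {I : Block m} (h : IsStrongInterval σ I) : I.1 ≤ I.2 := h.1.1

/-- Two strong intervals with a common position are nested. -/
theorem IsStrongInterval.nested {I J : Block m} (hI : IsStrongInterval σ I)
    (hJ : IsStrongInterval σ J) (h : (I.positions ∩ J.positions).Nonempty) :
    I.positions ⊆ J.positions ∨ J.positions ⊆ I.positions := by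
  by_contra! hcon
  exact hI.2 J hJ.1 ⟨Set.sdiff_nonempty.2 hcon.1, Set.sdiff_nonempty.2 hcon.2, h⟩

end SepPerm

namespace SepPerm
variable {m : ℕ} {σ : Equiv.Perm (Fin m)}

/-! ### Children of a strong interval -/

theorem mem_children {I J : Block m} : J ∈ children σ I ↔ IsChild σ I J := by
  simp only [children, List.mem_filter, decide_eq_true_eq, and_iff_right_iff_imp]
  exact fun _ => List.mem_product.2 ⟨List.mem_finRange _, List.mem_finRange _⟩

theorem children_lex (σ : Equiv.Perm (Fin m)) (I : Block m) :
    (children σ I).Pairwise fun J K => J.1 < K.1 ∨ J.1 = K.1 ∧ J.2 < K.2 := by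
  unfold children
  apply List.Pairwise.filter
  simp only [SProd.sprod, List.product]
  rw [List.pairwise_flatMap]
  refine ⟨fun a _ => ?_, (List.pairwise_lt_finRange m).imp fun hab => ?_⟩
  · rw [List.pairwise_map]
    exact (List.pairwise_lt_finRange m).imp fun h => .inr ⟨rfl, h⟩
  · simp only [List.mem_map]
    rintro _ ⟨_, -, rfl⟩ _ ⟨_, -, rfl⟩
    exact .inl hab

theorem IsChild.le {I J : Block m} (h : IsChild σ I J) : J.1 ≤ J.2 := h.1.1.1

theorem IsChild.bounds {I J : Block m} (h : IsChild σ I J) :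
    I.1 ≤ J.1 ∧ J.2 ≤ I.2 ∧ (I.1 < J.1 ∨ J.2 < I.2) := by
  have h1 := (positions_subset_iff h.le).1 h.2.1.1
  have := h.le
  exact (positions_ssubset_iff (by omega) h.le).1 h.2.1

theorem IsChild.eq_of_mem {I J K : Block m} (hJ : IsChild σ I J) (hK : IsChild σ I K)
    {x : Fin m} (hxJ : x ∈ J.positions) (hxK : x ∈ K.positions) : J = K := by
  rcases hJ.1.nested hK.1 ⟨x, hxJ, hxK⟩ with h | h
  · exact (hJ.2.2 K hK.1 h hK.2.1).symm
  · exact hK.2.2 J hJ.1 h hJ.2.1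

/-- Distinct children are disjoint, which upgrades the lexicographic order to an order of whole
blocks. -/
theorem children_sorted (σ : Equiv.Perm (Fin m)) (I : Block m) :
    (children σ I).Pairwise fun J K => J.2 < K.1 := by
  refine (children_lex σ I).imp_of_mem fun {J K} hJ hK h => ?_
  rw [mem_children] at hJ hK
  by_contra hcon
  have h1 := hJ.le
  have h2 := hK.le
  have hx : K.1 ∈ J.positions := ⟨by omega, by omega⟩
  obtain rfl := hJ.eq_of_mem hK hx ⟨le_rfl, h2⟩
  omega

theorem exists_isChild {I J : Block m} (hJ : IsStrongInterval σ J)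
    (hJI : J.positions ⊂ I.positions) :
    ∃ K, IsChild σ I K ∧ J.positions ⊆ K.positions := by
  classical
  obtain ⟨K, hK, hmax⟩ := (Finset.univ.filter fun K : Block m => IsStrongInterval σ K ∧
    J.positions ⊆ K.positions ∧ K.positions ⊂ I.positions).exists_max_image
      (fun K => (K.2 : ℕ) - K.1) ⟨J, by simp [hJ, hJI]⟩
  simp only [Finset.mem_filter, Finset.mem_univ, true_and] at hK hmax
  refine ⟨K, ⟨hK.1, hK.2.2, fun K' hK' hsub hss => ?_⟩, hK.2.1⟩
  have := hmax K' ⟨hK', hK.2.1.trans hsub, hss⟩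
  have h1 := (positions_subset_iff hK.1.le).1 hsub
  have h2 := hK.1.le
  have h3 := hK'.le
  exact Prod.ext (by omega) (by omega)

/-- Singletons are strong, so each position lies in a maximal proper strong subinterval. -/
theorem exists_isChild_mem {I : Block m} (hI : I.1 < I.2) {x : Fin m} (hx : I.1 ≤ x)
    (hx' : x ≤ I.2) : ∃ K, IsChild σ I K ∧ K.1 ≤ x ∧ x ≤ K.2 := by
  have hs : IsStrongInterval σ ((x, x) : Block m) :=
    (isStrongInterval_iff _).2 (strongInt_singleton x.2)
  obtain ⟨K, hK, hsub⟩ := exists_isChild (I := I) hs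
    ((positions_ssubset_iff hI.le le_rfl).2 ⟨hx, hx', by simp only; omega⟩)
  exact ⟨K, hK, (positions_subset_iff (J := (x, x)) le_rfl).1 hsub⟩

theorem children_get_lt {I : Block m} {k l : Fin (children σ I).length} (h : k < l) :
    ((children σ I).get k).2 < ((children σ I).get l).1 :=
  List.pairwise_iff_get.1 (children_sorted σ I) k l h

theorem isChild_get {I : Block m} (k : Fin (children σ I).length) :
    IsChild σ I ((children σ I).get k) :=
  mem_children.1 (List.get_mem _ k)

/-- The union of consecutive children is a block. -/
theorem iUnion_children {I : Block m} (hlt : I.1 < I.2) {i j : Fin (children σ I).length}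
    (hij : i ≤ j) :
    (⋃ l ∈ Set.Icc i j, σ '' ((children σ I).get l).positions) =
      σ '' Block.positions (((children σ I).get i).1, ((children σ I).get j).2) := by
  have hi := (isChild_get i).bounds
  have hj := (isChild_get j).bounds
  rw [← Set.image_iUnion₂]
  congr 1
  ext x
  simp only [Set.mem_iUnion, mem_positions, Set.mem_Icc, exists_prop]
  symm
  constructor
  · rintro ⟨hx, hx'⟩
    obtain ⟨K, hK, hK1, hK2⟩ := exists_isChild_mem (σ := σ) (x := x) hlt (by omega) (by omega)
    obtain ⟨k, rfl⟩ := List.get_of_mem (mem_children.2 hK)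
    refine ⟨k, ⟨?_, ?_⟩, by omega, by omega⟩
    · by_contra hk
      have := children_get_lt (show k < i by omega)
      omega
    · by_contra hk
      have := children_get_lt (show j < k by omega)
      omega
  · rintro ⟨k, ⟨hik, hkj⟩, hx, hx'⟩
    have := (isChild_get i).le
    have := (isChild_get j).le
    constructor
    · rcases hik.eq_or_lt with rfl | h
      · exact hx
      · have := children_get_lt h
        omega
    · rcases hkj.eq_or_lt with rfl | h
      · exact hx'
      · have := children_get_lt h
        omega

/-- A strong interval that is no singleton and no prime vertex splits. -/
theorem splits_of_not_isPrimeNode {I : Block m} (hI : IsStrongInterval σ I) (hlt : I.1 < I.2)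
    (hp : ¬ IsPrimeNode σ I) : Splits (word σ) I.1 (I.2 + 1) := by
  classical
  by_contra hcon
  refine hp ⟨?_, fun i j hij hord => ?_⟩
  -- `V` is the first child and `W` the next. If `W` reached the end, the two would split `I`; hence
  -- there is a third.
  · obtain ⟨V, hV, hV1, hV2⟩ := exists_isChild_mem (σ := σ) hlt le_rfl hlt.le
    have hVb := hV.bounds
    obtain ⟨x, hx⟩ : ∃ x : Fin m, (x : ℕ) = V.2 + 1 := ⟨⟨V.2 + 1, by omega⟩, rfl⟩
    obtain ⟨W, hW, hW1, hW2⟩ := exists_isChild_mem (σ := σ) (x := x) hlt (by omega) (by omega)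
    have hWb := hW.bounds
    have hVW : V ≠ W := by rintro rfl; omega
    have hW3 : ¬ W.1 ≤ V.2 := fun h =>
      hVW (hV.eq_of_mem hW (x := V.2) ⟨hV.le, le_rfl⟩ ⟨h, by omega⟩)
    by_cases hWI : W.2 = I.2
    · refine (hcon (splits_of_commonInt (m := m) (c := W.1) ?_ ?_ (word_injective σ))).elim
      · have := (isCommonInterval_iff V).1 hV.1.1
        rwa [show (V.1 : ℕ) = I.1 by omega, show (V.2 : ℕ) + 1 = W.1 by omega] at this
      · have := (isCommonInterval_iff W).1 hW.1.1
        rwa [hWI] at this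
    obtain ⟨y, hy⟩ : ∃ y : Fin m, (y : ℕ) = W.2 + 1 := ⟨⟨W.2 + 1, by omega⟩, rfl⟩
    obtain ⟨X, hX, hX1, hX2⟩ := exists_isChild_mem (σ := σ) (x := y) hlt (by omega) (by omega)
    have hVX : V ≠ X := by rintro rfl; omega
    have hWX : W ≠ X := by rintro rfl; omega
    calc 3 = ({V, W, X} : Finset (Block m)).card := (Finset.card_eq_three.2
            ⟨V, W, X, hVW, hVX, hWX, rfl⟩).symm
      _ ≤ (children σ I).toFinset.card := Finset.card_le_card fun Y hY => by
            simp only [Finset.mem_insert, Finset.mem_singleton] at hY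
            rw [List.mem_toFinset, mem_children]
            rcases hY with rfl | rfl | rfl <;> assumption
      _ ≤ _ := List.toFinset_card_le _
  · by_contra hne
    have hi := (isChild_get i).bounds
    have hj := (isChild_get j).bounds
    have hi' := (isChild_get i).le
    have hj' := (isChild_get j).le
    have hij' := children_get_lt hij
    have hU : IsCommonInterval σ (((children σ I).get i).1, ((children σ I).get j).2) := by
      refine ⟨by simp only; omega, ?_⟩
      rwa [← iUnion_children hlt hij.le]
    rw [isCommonInterval_iff] at hU
    refine hcon (((isStrongInterval_iff I).1 hI).splits_of_maximal (word_injective σ) hU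
      (by simp only; omega) (by simp only; omega) ?_ ?_)
    · simp only
      by_cases h0 : (i : ℕ) = 0
      · have h1 : (j : ℕ) + 1 < (children σ I).length := by have := j.2; omega
        have := children_get_lt (show j < ⟨j + 1, h1⟩ by rw [Fin.lt_def]; simp)
        have := (isChild_get (σ := σ) (I := I) ⟨j + 1, h1⟩).bounds
        have := (isChild_get (σ := σ) (I := I) ⟨j + 1, h1⟩).le
        omega
      · have := children_get_lt (show ⟨0, by have := i.2; omega⟩ < i by
          rw [Fin.lt_def]; simp only; omega)
        have := (isChild_get (σ := σ) (I := I) ⟨0, by have := i.2; omega⟩).bounds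
        have := (isChild_get (σ := σ) (I := I) ⟨0, by have := i.2; omega⟩).le
        omega
    -- A proper strong interval containing the union contains child `i`, hence equals it by
    -- maximality, and so misses child `j`.
    · intro p q hpq hp1 hp2 hq1 hq2 hne'
      simp only at hp2 hq1
      obtain ⟨P, rfl, rfl⟩ := exists_block hpq.1.1 hpq.1.2.1
      rw [← isStrongInterval_iff] at hpq
      have := (isChild_get i).2.2 P hpq ((positions_subset_iff hi').2 (by omega))
        ((positions_ssubset_iff hlt.le hpq.le).2 (by omega))
      rw [this] at hq1
      omega

/-! ### Vertices of the decomposition tree -/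

theorem OTree.HasNode.map {N L N' L' : Type} {a : N} {t : OTree N L} (h : t.HasNode a)
    (g : N → N') (g' : L → L') : (t.map g g').HasNode (g a) := by
  induction h with
  | root cs => rw [OTree.map]; exact .root _
  | child b cs c hc _ ih => rw [OTree.map]; exact .child _ _ _ (List.mem_map_of_mem hc) ih

theorem strongTree_of_lt {I : Block m} (h : I.1 < I.2) :
    strongTree σ I = .node I ((children σ I).map (strongTree σ)) := by
  rw [strongTree, if_neg h.ne, List.attach_map_val (f := strongTree σ)]

theorem hasNode_strongTree {J : Block m} (hJ : IsStrongInterval σ J) (hlt : J.1 < J.2) :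
    ∀ N, ∀ I : Block m, (I.2 : ℕ) - I.1 ≤ N → I.1 ≤ J.1 → J.2 ≤ I.2 →
      (strongTree σ I).HasNode J := by
  intro N
  induction N with
  | zero => intro I; omega
  | succ N ih =>
    intro I hN h1 h2
    rw [strongTree_of_lt (by omega)]
    by_cases hIJ : I = J
    · subst hIJ; exact .root _
    · have hne : I.1 < J.1 ∨ J.2 < I.2 := by
        by_contra hcon
        exact hIJ (Prod.ext (by omega) (by omega))
      obtain ⟨K, hK, hsub⟩ := exists_isChild hJ
        ((positions_ssubset_iff (I := I) (by omega) hlt.le).2 ⟨h1, h2, hne⟩)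
      rw [positions_subset_iff hlt.le] at hsub
      have := hK.bounds
      exact .child _ _ _ (List.mem_map_of_mem (mem_children.2 hK))
        (ih K (by omega) hsub.1 hsub.2)

end SepPerm

namespace SepPerm

/-! ### Contracted trees and labeled subtrees -/

theorem OTree.not_hasNode_leaf {N L : Type} {a : N} {l : L} :
    ¬ (OTree.leaf l : OTree N L).HasNode a := by
  rintro ⟨⟩

/-- Contracted trees have no prime vertices. -/
theorem not_hasNode_prime_contract (d : ℕ) (π : Equiv.Perm (Fin d)) (T : BinTree) :
    ¬ (contract T).HasNode (.prime d π) := by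
  have key : ∀ s (t : LabeledTree), ¬ t.HasNode (.prime d π) → ∀ c ∈ absorb s t,
      ¬ c.HasNode (.prime d π) := by
    intro s t ht c hc
    unfold absorb at hc
    split at hc
    · split_ifs at hc
      · exact fun h => ht (.child _ _ c hc h)
      · rwa [List.mem_singleton.1 hc]
    · rwa [List.mem_singleton.1 hc]
  induction T with
  | leaf => exact OTree.not_hasNode_leaf
  | node s l r ihl ihr =>
    intro h
    rw [contract] at h
    cases h with
    | child _ _ c hc h =>
      rcases List.mem_append.1 hc with hc | hc
      · exact key s _ ihl c hc h
      · exact key s _ ihr c hc h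

variable {n : ℕ} {σ : Equiv.Perm (Fin (n + 1))}

/-- The block of the positions `a, …, b - 1`. -/
def toBlock (n a b : ℕ) : Block (n + 1) := (Fin.ofNat (n + 1) a, Fin.ofNat (n + 1) (b - 1))

theorem toBlock_fst {a b : ℕ} (hab : a < b) (hb : b ≤ n + 1) : ((toBlock n a b).1 : ℕ) = a :=
  Nat.mod_eq_of_lt (by omega)

theorem toBlock_snd {a b : ℕ} (hab : a < b) (hb : b ≤ n + 1) :
    ((toBlock n a b).2 : ℕ) + 1 = b := by
  have : ((toBlock n a b).2 : ℕ) = b - 1 := Nat.mod_eq_of_lt (by omega)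
  omega

/-- The labeled tree of the strong intervals included in `I`. -/
noncomputable def labeledSubtree (σ : Equiv.Perm (Fin (n + 1))) (I : Block (n + 1)) :
    LabeledTree :=
  ((strongTree σ I).map (fun I => (nodeType σ I, I)) id).map (nodeLabel σ) fun _ => ()

theorem labeledSubtree_of_lt {I : Block (n + 1)} (h : I.1 < I.2) :
    labeledSubtree σ I =
      .node (nodeLabel σ (nodeType σ I, I)) ((children σ I).map (labeledSubtree σ)) := by
  rw [labeledSubtree, strongTree_of_lt h, OTree.map, OTree.map, List.map_map, List.map_map]
  rfl

/-! ### Parts of a separating tree as children of a strong interval -/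

section Parts

variable {I : Block (n + 1)} {s : Sgn} {L : List (BinTree × ℕ × ℕ)}

theorem IsPart.toBlock_fst {e : BinTree × ℕ × ℕ}
    (he : IsPart (word σ) s I.1 (I.2 + 1) e.1 e.2.1 e.2.2) :
    ((toBlock n e.2.1 e.2.2).1 : ℕ) = e.2.1 :=
  SepPerm.toBlock_fst he.lt (by have := he.le'; omega)

theorem IsPart.toBlock_snd {e : BinTree × ℕ × ℕ}
    (he : IsPart (word σ) s I.1 (I.2 + 1) e.1 e.2.1 e.2.2) :
    ((toBlock n e.2.1 e.2.2).2 : ℕ) + 1 = e.2.2 :=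
  SepPerm.toBlock_snd he.lt (by have := he.le'; omega)

/-- Both lists increase strictly by left end, so equal membership suffices. Parts are maximal proper
strong intervals; a child meets the part covering its left end, is nested with it, and so equals it.
-/
theorem children_eq_parts (hI : IsStrongInterval σ I) (hlt : I.1 < I.2)
    (hL : ∀ e ∈ L, IsPart (word σ) s I.1 (I.2 + 1) e.1 e.2.1 e.2.2)
    (hsort : L.Pairwise (fun e e' => e.2.2 ≤ e'.2.1))
    (hcov : ∀ x, (I.1 : ℕ) ≤ x → x < I.2 + 1 → ∃ e ∈ L, e.2.1 ≤ x ∧ x < e.2.2)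
    (hprop : ∀ e ∈ L, e.2.2 - e.2.1 < (I.2 + 1 : ℕ) - I.1) :
    children σ I = L.map fun e => toBlock n e.2.1 e.2.2 := by
  have hstr : ∀ e ∈ L, IsStrongInterval σ (toBlock n e.2.1 e.2.2) := fun e he => by
    rw [isStrongInterval_iff, (hL e he).toBlock_fst, (hL e he).toBlock_snd]
    exact (hL e he).strongInt ((isStrongInterval_iff I).1 hI)
  have hI' := (isStrongInterval_iff I).1 hI
  have hmax : ∀ e ∈ L, ∀ K, IsStrongInterval σ K → K.positions ⊂ I.positions →
      (toBlock n e.2.1 e.2.2).positions ⊆ K.positions → K = toBlock n e.2.1 e.2.2 := by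
    intro e he K hK hKI hsub
    have h1 := (hL e he).toBlock_fst
    have h2 := (hL e he).toBlock_snd
    have h3 := (positions_ssubset_iff hI.le hK.le).1 hKI
    have h4 := (positions_subset_iff (hstr e he).le).1 hsub
    obtain ⟨h5, h6⟩ := (hL e he).eq_of_strongInt hI'.1 ((isStrongInterval_iff K).1 hK)
      (by omega) (by omega) (by omega) (by omega) (by omega)
    exact Prod.ext (by omega) (by omega)
  have hss : ∀ e ∈ L, (toBlock n e.2.1 e.2.2).positions ⊂ I.positions := by
    intro e he
    have h1 := (hL e he).toBlock_fst
    have h2 := (hL e he).toBlock_snd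
    have h3 := hprop e he
    have h4 := (hL e he).le
    have h5 := (hL e he).le'
    rw [positions_ssubset_iff hI.le (hstr e he).le]
    omega
  have : Std.Irrefl fun J K : Block (n + 1) => J.1 < K.1 := ⟨fun J => lt_irrefl J.1⟩
  have : Std.Antisymm fun J K : Block (n + 1) => J.1 < K.1 :=
    ⟨fun J K h h' => absurd h h'.asymm⟩
  refine List.Pairwise.eq_of_mem_iff (r := fun J K : Block (n + 1) => J.1 < K.1)
    ((children_sorted σ I).imp_of_mem fun {J K} hJ _ h => ?_) ?_ fun J => ?_
  · exact (mem_children.1 hJ).le.trans_lt h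
  · rw [List.pairwise_map]
    refine hsort.imp_of_mem fun {e e'} he he' h => ?_
    have h1 := (hL e he).toBlock_fst
    have h2 := (hL e' he').toBlock_fst
    have h3 := (hL e he).lt
    omega
  · rw [mem_children, List.mem_map]
    constructor
    · intro hJ
      have hb := hJ.bounds
      have hJ' := hJ.le
      obtain ⟨e, he, hx, hx'⟩ := hcov J.1 (by omega) (by omega)
      have h1 := (hL e he).toBlock_fst
      have h2 := (hL e he).toBlock_snd
      refine ⟨e, he, ?_⟩
      rcases hJ.1.nested (hstr e he) ⟨J.1, ⟨le_rfl, hJ'⟩, ⟨by omega, by omega⟩⟩ with h | h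
      · exact hJ.2.2 _ (hstr e he) h (hss e he)
      · exact (hmax e he J hJ.1 hJ.2.1 h).symm
    · rintro ⟨e, he, rfl⟩
      exact ⟨hstr e he, hss e he, fun K hK hsub hKI => hmax e he K hK hKI hsub⟩

/-- The cut after the second child makes the union of the first two a common interval, which
primality forbids when there are at least three. -/
theorem not_isPrimeNode_of_parts (hI : IsStrongInterval σ I) (hlt : I.1 < I.2)
    (hL : ∀ J ∈ children σ I, SplitsAt (word σ) s I.1 (J.2 + 1) (I.2 + 1)) :
    ¬ IsPrimeNode σ I := by
  rintro ⟨h3, hp⟩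
  have h01 : (⟨0, by omega⟩ : Fin (children σ I).length) < ⟨1, by omega⟩ := by
    rw [Fin.lt_def]; simp
  refine absurd (hp _ _ h01 ?_).2 (by simp only; omega)
  rw [iUnion_children hlt h01.le]
  have h0 := (isChild_get (σ := σ) (I := I) ⟨0, by omega⟩).bounds
  have h1 := (isChild_get (σ := σ) (I := I) ⟨1, by omega⟩).bounds
  have h1' := (isChild_get (σ := σ) (I := I) ⟨1, by omega⟩).le
  have hfst : ((children σ I).get ⟨0, by omega⟩).1 = I.1 := by
    obtain ⟨K, hK, hK1, hK2⟩ := exists_isChild_mem (σ := σ) hlt le_rfl hlt.le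
    obtain ⟨k, rfl⟩ := List.get_of_mem (mem_children.2 hK)
    by_contra hne
    have hk : (⟨0, by omega⟩ : Fin (children σ I).length) < k := by
      rw [Fin.lt_def]
      by_contra hk
      have hk0 : k = ⟨0, by omega⟩ := Fin.ext (by simp only at hk ⊢; omega)
      rw [hk0] at hK1
      omega
    have := children_get_lt hk
    have := (isChild_get (σ := σ) (I := I) ⟨0, by omega⟩).le
    omega
  rw [hfst]
  have hsp := hL _ (List.get_mem (children σ I) ⟨1, by omega⟩)
  refine ((isCommonInterval_iff (I.1, ((children σ I).get ⟨1, by omega⟩).2)).2 (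
    ((isCommonInterval_iff I).1 hI.1).left_of_splitsAt (s := s) ?_ ?_ hsp)).2
  · simp only; omega
  · simp only; omega

theorem childrenIncrease_iff_of_parts (hlt : I.1 < I.2)
    (hL : ∀ J ∈ children σ I, SplitsAt (word σ) s I.1 (J.2 + 1) (I.2 + 1)) :
    ChildrenIncrease σ I ↔ s = .plus := by
  have hval : ∀ J ∈ children σ I, ∀ K ∈ children σ I, J.2 < K.1 → ∀ x ∈ J.positions,
      ∀ y ∈ K.positions, signedVal (word σ) s x < signedVal (word σ) s y := by
    intro J hJ K hK hJK x hx y hy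
    have h1 := (mem_children.1 hJ).bounds
    have h2 := (mem_children.1 hK).bounds
    rw [mem_positions] at hx hy
    exact hL J hJ x y (by omega) (by omega) (by omega) (by omega)
  constructor
  · intro h
    cases s with
    | plus => rfl
    | minus =>
      exfalso
      -- The first and last children are distinct, and for sign `-` their values decrease.
      obtain ⟨V, hV, hV1, hV2⟩ := exists_isChild_mem (σ := σ) hlt le_rfl hlt.le
      obtain ⟨W, hW, hW1, hW2⟩ := exists_isChild_mem (σ := σ) hlt hlt.le le_rfl
      have hVb := hV.bounds
      have hWb := hW.bounds
      have hne : V ≠ W := by rintro rfl; omega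
      have hVW : V.2 < W.1 := by
        by_contra hcon
        exact hne (hV.eq_of_mem hW (x := W.1) ⟨by omega, by omega⟩ ⟨le_rfl, hW.le⟩)
      obtain ⟨i, rfl⟩ := List.get_of_mem (mem_children.2 hV)
      obtain ⟨j, rfl⟩ := List.get_of_mem (mem_children.2 hW)
      have hij : i < j := by
        by_contra hcon
        rcases (not_lt.1 hcon).eq_or_lt with rfl | hlt'
        · exact hne rfl
        · have := children_get_lt hlt'
          have := hV.le
          have := hW.le
          omega
      have h1 := List.pairwise_iff_get.1 h i j hij _ (Set.left_mem_Icc.2 hV.le) _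
        (Set.left_mem_Icc.2 hW.le)
      have h2 := hval _ (List.get_mem _ i) _ (List.get_mem _ j) hVW _
        (Set.left_mem_Icc.2 hV.le) _ (Set.left_mem_Icc.2 hW.le)
      simp only [signedVal, word_apply] at h2
      omega
  · rintro rfl
    refine (children_sorted σ I).imp_of_mem fun {J K} hJ hK hJK x hx y hy => ?_
    have := hval J hJ K hK hJK x hx y hy
    simp only [signedVal, word_apply] at this
    omega

end Parts

/-- The contraction of a separating tree of a strong interval is its labeled subtree. -/
theorem contract_eq_labeledSubtree (N : ℕ) : ∀ (T : BinTree) (I : Block (n + 1)),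
    (I.2 : ℕ) - I.1 ≤ N → IsStrongInterval σ I → Separates (word σ) T I.1 (I.2 + 1) →
    contract T = labeledSubtree σ I := by
  induction N using Nat.strong_induction_on with
  | _ N ih =>
    intro T I hN hI hT
    rcases hI.le.eq_or_lt with heq | hlt
    · have : T = .leaf := by
        generalize ha : (I.1 : ℕ) = a at hT
        generalize hb : (I.2 : ℕ) + 1 = b at hT
        cases hT with
        | leaf => rfl
        | node s l r _ c _ hl hr =>
          have := hl.lt
          have := hr.lt
          omega
      rw [this, labeledSubtree, strongTree, if_pos heq, OTree.map, OTree.map, contract]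
    · obtain ⟨s, l, r, rfl⟩ : ∃ s l r, T = .node s l r := by
        generalize ha : (I.1 : ℕ) = a at hT
        generalize hb : (I.2 : ℕ) + 1 = b at hT
        cases hT with
        | leaf => omega
        | node s l r _ c _ hl hr => exact ⟨s, l, r, rfl⟩
      -- Choosing the sign of the root makes the parts proper, so the induction can descend.
      obtain ⟨L, h1, h2, h3, h4, h5⟩ := exists_parts s hT
      have h5 := h5 ⟨l, r, rfl⟩
      have hch := children_eq_parts hI hlt h2 h3 h4 h5
      have hsp : ∀ J ∈ children σ I, SplitsAt (word σ) s I.1 (J.2 + 1) (I.2 + 1) := by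
        rw [hch]
        intro J hJ
        obtain ⟨e, he, rfl⟩ := List.mem_map.1 hJ
        rw [(h2 e he).toBlock_snd]
        exact (h2 e he).split'
      have hlab : nodeLabel σ (nodeType σ I, I) = .linear s := by
        rw [nodeType, if_neg (not_isPrimeNode_of_parts hI hlt hsp), nodeLabel]
        simp only [childrenIncrease_iff_of_parts hlt hsp]
        cases s <;> simp
      rw [labeledSubtree_of_lt hlt, hlab]
      -- Absorbing a root of its own sign returns its list of children, which `h1` describes.
      have hc : contract (.node s l r) = .node (.linear s) (absorb s (contract (.node s l r))) := by
        simp only [contract, absorb.eq_1, if_true]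
      rw [hc, h1, hch, List.map_map]
      congr 1
      refine List.map_congr_left fun e he => ?_
      have k1 := (h2 e he).toBlock_fst
      have k2 := (h2 e he).toBlock_snd
      have k3 := h5 e he
      have k4 := (h2 e he).lt
      refine ih (e.2.2 - 1 - e.2.1) (by omega) _ _ (by simp only; omega) ?_ ?_
      · rw [isStrongInterval_iff, k1, k2]
        exact (h2 e he).strongInt ((isStrongInterval_iff I).1 hI)
      · rw [k1, k2]
        exact (h2 e he).separates

/-! ### The whole permutation -/

theorem isStrongInterval_univ : IsStrongInterval σ (0, Fin.last n) := by
  rw [isStrongInterval_iff]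
  exact strongInt_univ (Nat.succ_pos n)

theorem contract_eq_labeledDecompositionTree {T : BinTree} (h : IsBinarySeparatingTree σ T) :
    contract T = labeledDecompositionTree σ := by
  rw [isBinarySeparatingTree_iff] at h
  exact contract_eq_labeledSubtree n T (0, Fin.last n) (by simp) isStrongInterval_univ
    (by simpa using h)

theorem isSeparable_of_isBinarySeparatingTree {T : BinTree} (h : IsBinarySeparatingTree σ T) :
    IsSeparable σ :=
  (isSeparable_iff σ).2 ((isBinarySeparatingTree_iff σ T).1 h).avoids

theorem exists_isBinarySeparatingTree_of_splits
    (h : ∀ a b, CommonInt (word σ) (n + 1) a b → a + 1 < b → Splits (word σ) a b) :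
    ∃ T, IsBinarySeparatingTree σ T := by
  obtain ⟨T, hT⟩ := exists_separates_of_splits h 0 (n + 1) (strongInt_univ (Nat.succ_pos n)).1
  exact ⟨T, (isBinarySeparatingTree_iff σ T).2 hT⟩

theorem IsSeparable.exists_isBinarySeparatingTree (h : IsSeparable σ) :
    ∃ T, IsBinarySeparatingTree σ T :=
  exists_isBinarySeparatingTree_of_splits fun _ _ hab hlt =>
    (((isSeparable_iff σ).1 h).mono (Nat.zero_le _) hab.2.1).splits (word_injective σ) hlt

theorem exists_isBinarySeparatingTree_of_no_prime
    (h : ∀ I : Block (n + 1), ¬ (commonIntervalTree σ).HasNode (NodeType.P, I)) :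
    ∃ T, IsBinarySeparatingTree σ T := by
  refine exists_isBinarySeparatingTree_of_splits fun a b hab hlt => ?_
  by_cases hs : StrongInt (word σ) (n + 1) a b
  · obtain ⟨I, rfl, rfl⟩ := exists_block hab.1 hab.2.1
    have hI := (isStrongInterval_iff I).2 hs
    have hlt' : I.1 < I.2 := by omega
    refine splits_of_not_isPrimeNode hI hlt' fun hp => h I ?_
    have := (hasNode_strongTree hI hlt' n (0, Fin.last n) (by simp) (Fin.zero_le _)
      (Fin.le_last _)).map (fun I => (nodeType σ I, I)) id
    rwa [nodeType, if_pos hp] at this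
  · exact hab.splits_of_not_strongInt (word_injective σ) hs

/-- A prime node would leave a permutation label in the labeled decomposition tree, which is a
contraction and carries only signs. -/
theorem no_prime_of_isBinarySeparatingTree {T : BinTree} (h : IsBinarySeparatingTree σ T)
    (I : Block (n + 1)) : ¬ (commonIntervalTree σ).HasNode (NodeType.P, I) := by
  intro hI
  refine not_hasNode_prime_contract (children σ I).length (childrenPerm σ (children σ I)) T ?_
  rw [contract_eq_labeledDecompositionTree h]
  exact hI.map (nodeLabel σ) fun _ => ()

end SepPerm

theorem mainTheorem6 (n : ℕ) (σ : Equiv.Perm (Fin (n + 1))) :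
    (SepPerm.IsSeparable σ ↔
      ∀ I : SepPerm.Block (n + 1),
        ¬ (SepPerm.commonIntervalTree σ).HasNode (SepPerm.NodeType.P, I)) ∧
    (SepPerm.IsSeparable σ →
      ∀ C : SepPerm.LabeledTree,
        SepPerm.IsContractedSeparatingTree σ C ↔ C = SepPerm.labeledDecompositionTree σ) := by
  refine ⟨⟨fun h => ?_, fun h => ?_⟩, fun h C => ⟨?_, ?_⟩⟩
  · obtain ⟨T, hT⟩ := h.exists_isBinarySeparatingTree
    exact SepPerm.no_prime_of_isBinarySeparatingTree hT
  · obtain ⟨T, hT⟩ := SepPerm.exists_isBinarySeparatingTree_of_no_prime h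
    exact SepPerm.isSeparable_of_isBinarySeparatingTree hT
  · rintro ⟨T, hT, rfl⟩
    exact SepPerm.contract_eq_labeledDecompositionTree hT
  · rintro rfl
    obtain ⟨T, hT⟩ := h.exists_isBinarySeparatingTree
    exact ⟨T, hT, SepPerm.contract_eq_labeledDecompositionTree hT⟩
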